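/- **Setting.** Let $\mathbb{F}_3=\langle a,b,c\rangle$ be the free group on three generators, let $S=\{a,b,c,a^{-1},b^{-1},c^{-1}\}$, and for a set $T$ generating $\mathbb{F}_3$ as a monoid let $|g|_T$ be the least $n\ge 0$ such that $g$ is a product of $n$ elements of $T$. For $j\ge 2$ put $$X_j=\{\,v\,b^{5^{2j-1}}v^{-1}a^{5^{2j}}b^{5^{2j}} : v\in\mathbb{F}_3,\ |v|_S\le 5^j\,\},\qquad X=S\cup\bigcup_{j\ge 2}X_j ,$$ and let $\omega(t)=\exp(|t|_X)$ for $t\in\mathbb{F}_3$. Let $\mathcal{A}=\ell^1(\mathbb{F}_3,\omega)$ be the Beurling algebra of all $f\colon\mathbb{F}_3\to\mathbb{C}$ with $\|f\|_\omega=\sum_t|f(t)|\,\omega(t)<\infty$, under convolution, and write $\widetilde\delta_u=\frac{1}{\omega(u)}\delta_u$ for the normalised point mass at $u\in\mathbb{F}_3$. Let $\Diamond$ be the Arens product on $\mathcal{A}^{**}$ given by $$\langle \Psi\Diamond\Phi,\lambda\rangle=\langle\Phi,\lambda\cdot\Psi\rangle,\quad \langle\lambda\cdot\Psi,f\rangle=\langle\Psi,f\cdot\lambda\rangle,\quad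 \langle f\cdot\lambda,g\rangle=\langle\lambda,g*f\rangle$$ for $\Phi,\Psi\in\mathcal{A}^{**}$, $\lambda\in\mathcal{A}^*$, $f,g\in\mathcal{A}$; then $(\mathcal{A}^{**},\Diamond)$ is a unital Banach algebra with unit $\delta_1$. An element of a unital complex algebra is called quasi-nilpotent if its spectrum is $\{0\}$. The weight $\omega$ is regarded as the functional $\langle\omega,f\rangle=\sum_t f(t)\,\omega(t)$ in $\mathcal{A}^*$. **Proposition 4.5.** Let $\Phi_0\in\mathcal{A}^{**}$ be a weak*-accumulation point of the sequence $(\widetilde\delta_{a^{5^{2n}}b^{5^{2n}}})_{n}$ and let $\Psi_0\in\mathcal{A}^{**}$ be a weak*-accumulation point of the sequence $(\widetilde\delta_{c^{n}})_{n}$. Then $\Phi_0\Diamond\Psi_0$ is not quasi-nilpotent in $(\mathcal{A}^{**},\Diamond)$. Indeed, $$\langle(\Phi_0\Diamond\Psi_0)^{\Diamond k},\omega\rangle=1\qquad\text{for every integer } k\ge 0,$$ where the zeroth power is the unit $\delta_1$. -/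

import Mathlib

noncomputable section

open Filter

/-! ### Arens product -/

namespace Arens

variable {A : Type*} [NormedRing A] [NormedAlgebra ℂ A]

/-- The functional `a · φ` on `A`, for `a ∈ A` and `φ ∈ A*`: `⟨a · φ, b⟩ = ⟨φ, b a⟩`. -/
def lact (a : A) (φ : StrongDual ℂ A) : StrongDual ℂ A :=
  φ.comp ((ContinuousLinearMap.mul ℂ A).flip a)

@[simp] theorem lact_apply (a : A) (φ : StrongDual ℂ A) (b : A) : lact a φ b = φ (b * a) := rfl

theorem norm_lact_le (a : A) (φ : StrongDual ℂ A) : ‖lact a φ‖ ≤ ‖φ‖ * ‖a‖ := by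
  refine ContinuousLinearMap.opNorm_le_bound _ (by positivity) fun b => ?_
  calc ‖φ (b * a)‖ ≤ ‖φ‖ * ‖b * a‖ := φ.le_opNorm _
    _ ≤ ‖φ‖ * (‖b‖ * ‖a‖) := by gcongr; exact norm_mul_le _ _
    _ = ‖φ‖ * ‖a‖ * ‖b‖ := by ring

/-- The functional `φ · Ψ` on `A`, for `φ ∈ A*` and `Ψ ∈ A**`:
`⟨φ · Ψ, a⟩ = ⟨Ψ, a · φ⟩`. -/
def ract (φ : StrongDual ℂ A) (Ψ : StrongDual ℂ (StrongDual ℂ A)) : StrongDual ℂ A :=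
  LinearMap.mkContinuous
    { toFun := fun a => Ψ (lact a φ)
      map_add' := fun a b => by
        rw [← map_add]; congr 1; ext x; simp [mul_add]
      map_smul' := fun r a => by
        rw [RingHom.id_apply, ← map_smul]; congr 1; ext x; simp }
    (‖Ψ‖ * ‖φ‖) fun a =>
      calc ‖Ψ (lact a φ)‖ ≤ ‖Ψ‖ * ‖lact a φ‖ := Ψ.le_opNorm _
        _ ≤ ‖Ψ‖ * (‖φ‖ * ‖a‖) := by gcongr; exact norm_lact_le _ _
        _ = ‖Ψ‖ * ‖φ‖ * ‖a‖ := by ring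

@[simp] theorem ract_apply (φ : StrongDual ℂ A) (Ψ : StrongDual ℂ (StrongDual ℂ A)) (a : A) :
    ract φ Ψ a = Ψ (lact a φ) := rfl

theorem norm_ract_le (φ : StrongDual ℂ A) (Ψ : StrongDual ℂ (StrongDual ℂ A)) :
    ‖ract φ Ψ‖ ≤ ‖Ψ‖ * ‖φ‖ :=
  LinearMap.mkContinuous_norm_le _ (by positivity) _

/-- The Arens product `Ψ ◇ Φ` on `A**`: `⟨Ψ ◇ Φ, φ⟩ = ⟨Φ, φ · Ψ⟩`. -/
def diamond (Ψ Φ : StrongDual ℂ (StrongDual ℂ A)) : StrongDual ℂ (StrongDual ℂ A) :=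
  LinearMap.mkContinuous
    { toFun := fun φ => Φ (ract φ Ψ)
      map_add' := fun φ χ => by
        rw [← map_add]; congr 1; ext x
        simp only [ract_apply, add_apply, ← map_add]; rfl
      map_smul' := fun r φ => by
        rw [RingHom.id_apply, ← map_smul]; congr 1; ext x
        simp only [ract_apply, smul_apply, ← map_smul]; rfl }
    (‖Ψ‖ * ‖Φ‖) fun φ =>
      calc ‖Φ (ract φ Ψ)‖ ≤ ‖Φ‖ * ‖ract φ Ψ‖ := Φ.le_opNorm _
        _ ≤ ‖Φ‖ * (‖Ψ‖ * ‖φ‖) := by gcongr; exact norm_ract_le _ _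
        _ = ‖Ψ‖ * ‖Φ‖ * ‖φ‖ := by ring

@[simp] theorem diamond_apply (Ψ Φ : StrongDual ℂ (StrongDual ℂ A)) (φ : StrongDual ℂ A) :
    diamond Ψ Φ φ = Φ (ract φ Ψ) := rfl

theorem norm_diamond_le (Ψ Φ : StrongDual ℂ (StrongDual ℂ A)) :
    ‖diamond Ψ Φ‖ ≤ ‖Ψ‖ * ‖Φ‖ :=
  LinearMap.mkContinuous_norm_le _ (by positivity) _

variable (A) in
/-- The algebra `(A**, ◇)`: the normed space `A**` with the product `◇`. -/
def DiamondBidual : Type _ := StrongDual ℂ (StrongDual ℂ A)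

namespace DiamondBidual

instance : NormedAddCommGroup (DiamondBidual A) :=
  inferInstanceAs (NormedAddCommGroup (StrongDual ℂ (StrongDual ℂ A)))

instance : NormedSpace ℂ (DiamondBidual A) :=
  inferInstanceAs (NormedSpace ℂ (StrongDual ℂ (StrongDual ℂ A)))

instance : CompleteSpace (DiamondBidual A) :=
  inferInstanceAs (CompleteSpace (StrongDual ℂ (StrongDual ℂ A)))

/-- An element of `(A**, ◇)` regarded as a functional on `A*`. -/
def toDual (Φ : DiamondBidual A) : StrongDual ℂ (StrongDual ℂ A) := Φ

/-- The multiplication of `(A**, ◇)` is `◇`, and its unit is the image of `1 ∈ A`. -/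
instance : NormedRing (DiamondBidual A) :=
  { (inferInstance : NormedAddCommGroup (DiamondBidual A)) with
    mul := fun Ψ Φ => diamond Ψ Φ
    one := NormedSpace.inclusionInDoubleDual ℂ A 1
    left_distrib := fun a b c => by
      refine ContinuousLinearMap.ext fun φ => ?_
      rfl
    right_distrib := fun a b c => by
      refine ContinuousLinearMap.ext fun φ => ?_
      exact map_add (toDual c) (ract φ (toDual a)) (ract φ (toDual b))
    zero_mul := fun a => by
      refine ContinuousLinearMap.ext fun φ => ?_
      exact map_zero (toDual a)
    mul_zero := fun a => by
      refine ContinuousLinearMap.ext fun φ => ?_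
      rfl
    mul_assoc := fun a b c => by
      refine ContinuousLinearMap.ext fun φ => ?_
      refine congrArg (toDual c) (ContinuousLinearMap.ext fun x => ?_)
      refine congrArg (toDual b) (ContinuousLinearMap.ext fun y => ?_)
      refine congrArg (toDual a) (ContinuousLinearMap.ext fun z => ?_)
      exact congrArg φ (mul_assoc z y x)
    one_mul := fun a => by
      refine ContinuousLinearMap.ext fun φ => ?_
      refine congrArg (toDual a) (ContinuousLinearMap.ext fun x => ?_)
      exact congrArg φ (one_mul x)
    mul_one := fun a => by
      refine ContinuousLinearMap.ext fun φ => ?_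
      refine congrArg (toDual a) (ContinuousLinearMap.ext fun x => ?_)
      exact congrArg φ (mul_one x)
    norm_mul_le := fun a b => norm_diamond_le (toDual a) (toDual b) }

instance : NormedAlgebra ℂ (DiamondBidual A) :=
  { Algebra.ofModule
      (fun r x y => by
        refine ContinuousLinearMap.ext fun φ => ?_
        exact map_smul (toDual y) r (ract φ (toDual x)))
      (fun r x y => by
        refine ContinuousLinearMap.ext fun φ => ?_
        rfl) with
    norm_smul_le := fun r x => norm_smul_le r x }

theorem mul_def (Ψ Φ : DiamondBidual A) : (Ψ * Φ).toDual = diamond Ψ.toDual Φ.toDual := rfl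

end DiamondBidual

/-- `Φ ∈ A**` is a weak*-accumulation point of the sequence `(u n)` in `A` (embedded in `A**`):
equivalently, it is the weak*-limit of a subnet of that sequence. -/
def IsWeakStarAccPt (u : ℕ → A) (Φ : StrongDual ℂ (StrongDual ℂ A)) : Prop :=
  MapClusterPt (StrongDual.toWeakDual Φ) atTop
    (fun n => StrongDual.toWeakDual (NormedSpace.inclusionInDoubleDual ℂ A (u n)))

/-- An element of a unital complex algebra is quasi-nilpotent if its spectrum is `{0}`. -/
def IsQuasiNilpotent {B : Type*} [Ring B] [Algebra ℂ B] (x : B) : Prop :=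
  spectrum ℂ x = {0}

end Arens

/-! ### Weights and Beurling algebras -/

/-- A weight on a group `G`. -/
structure Weight (G : Type*) [Group G] where
  toFun : G → ℝ
  pos' : ∀ s, 0 < toFun s
  map_one' : toFun 1 = 1
  map_mul_le' : ∀ s t, toFun (s * t) ≤ toFun s * toFun t

instance {G : Type*} [Group G] : CoeFun (Weight G) (fun _ => G → ℝ) := ⟨Weight.toFun⟩

variable {G : Type*} [Group G]

/-- The functions `f : G → ℂ` with `∑ |f t| ω t < ∞`, as a subspace of all functions. -/
def beurlingSubmodule (ω : Weight G) : Submodule ℂ (G → ℂ) where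
  carrier := {f | Summable fun t => ‖f t‖ * ω t}
  zero_mem' := by simp
  add_mem' := fun {f g} hf hg => by
    refine Summable.of_nonneg_of_le (fun t => mul_nonneg (norm_nonneg _) (ω.pos' t).le)
      (fun t => ?_) (Summable.add hf hg)
    rw [← add_mul]
    exact mul_le_mul_of_nonneg_right (norm_add_le _ _) (ω.pos' t).le
  smul_mem' := fun c f hf => by
    have : (fun t => ‖(c • f) t‖ * ω t) = fun t => ‖c‖ * (‖f t‖ * ω t) := by
      ext t; simp [mul_assoc]
    change Summable _
    rw [this]
    exact Summable.mul_left _ hf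

/-- The Beurling algebra `ℓ¹(G, ω)`, with norm `∑ |f t| ω t` and convolution product. -/
def Beurling (ω : Weight G) : Type _ := beurlingSubmodule ω

namespace Beurling

variable {ω : Weight G}

instance : AddCommGroup (Beurling ω) := inferInstanceAs (AddCommGroup (beurlingSubmodule ω))

instance : Module ℂ (Beurling ω) := inferInstanceAs (Module ℂ (beurlingSubmodule ω))

instance : CoeFun (Beurling ω) (fun _ => G → ℂ) := ⟨fun f => Subtype.val f⟩

@[ext] theorem ext {f g : Beurling ω} (h : ∀ t, f t = g t) : f = g := Subtype.ext (funext h)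

@[simp] theorem zero_apply (t : G) : (0 : Beurling ω) t = 0 := rfl
@[simp] theorem add_apply (f g : Beurling ω) (t : G) : (f + g) t = f t + g t := rfl
@[simp] theorem neg_apply (f : Beurling ω) (t : G) : (-f) t = -f t := rfl
@[simp] theorem smul_apply (c : ℂ) (f : Beurling ω) (t : G) : (c • f) t = c * f t := rfl

theorem summable (f : Beurling ω) : Summable fun t => ‖f t‖ * ω t := f.2

theorem term_nonneg (f : G → ℂ) (t : G) : 0 ≤ ‖f t‖ * ω t :=
  mul_nonneg (norm_nonneg _) (ω.pos' t).le

instance : Norm (Beurling ω) := ⟨fun f => ∑' t, ‖f t‖ * ω t⟩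

theorem norm_def (f : Beurling ω) : ‖f‖ = ∑' t, ‖f t‖ * ω t := rfl

theorem term_le_norm (f : Beurling ω) (t : G) : ‖f t‖ * ω t ≤ ‖f‖ :=
  f.summable.le_tsum t fun s _ => term_nonneg f s

instance : NormedAddCommGroup (Beurling ω) :=
  AddGroupNorm.toNormedAddCommGroup
    { toFun := fun f => ‖f‖
      map_zero' := by simp [norm_def]
      add_le' := fun f g => by
        rw [norm_def, norm_def, norm_def, ← f.summable.tsum_add g.summable]
        refine (f + g).summable.tsum_le_tsum (fun t => ?_) (f.summable.add g.summable)
        rw [← add_mul]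
        exact mul_le_mul_of_nonneg_right (norm_add_le _ _) (ω.pos' t).le
      neg' := fun f => by simp [norm_def]
      eq_zero_of_map_eq_zero' := fun f hf => by
        ext t
        have h1 : ‖f t‖ * ω t ≤ 0 := hf ▸ term_le_norm f t
        have h2 := ω.pos' t
        have h3 : ‖f t‖ ≤ 0 := by
          by_contra h
          exact absurd h1 (not_le.mpr (mul_pos (not_le.mp h) h2))
        simpa using h3 }

instance : NormedSpace ℂ (Beurling ω) where
  norm_smul_le := fun c f => by
    refine le_of_eq ?_
    rw [norm_def, norm_def, ← tsum_mul_left]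
    simp [mul_assoc]

/-- The reindexed product `(s, t) ↦ |f s| ω s |g (s⁻¹ t)| ω (s⁻¹ t)` is summable, with sum
`‖f‖ ‖g‖`. -/
theorem hasSum_prod (f g : Beurling ω) :
    HasSum (fun p : G × G => (‖f p.1‖ * ω p.1) * (‖g (p.1⁻¹ * p.2)‖ * ω (p.1⁻¹ * p.2)))
      (‖f‖ * ‖g‖) := by
  have h := f.summable.hasSum.mul g.summable.hasSum
    (f.summable.mul_of_nonneg g.summable (term_nonneg f) (term_nonneg g))
  let e : G × G ≃ G × G :=
    { toFun := fun p => (p.1, p.1⁻¹ * p.2)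
      invFun := fun p => (p.1, p.1 * p.2)
      left_inv := fun p => by simp
      right_inv := fun p => by simp }
  exact (e.hasSum_iff (f := fun p : G × G => (‖f p.1‖ * ω p.1) * (‖g p.2‖ * ω p.2))).mpr h

theorem weight_le (s t : G) : ω t ≤ ω s * ω (s⁻¹ * t) := by
  simpa using ω.map_mul_le' s (s⁻¹ * t)

theorem conv_term_le (f g : Beurling ω) (s t : G) :
    ‖f s * g (s⁻¹ * t)‖ * ω t ≤ (‖f s‖ * ω s) * (‖g (s⁻¹ * t)‖ * ω (s⁻¹ * t)) := by
  rw [norm_mul]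
  calc ‖f s‖ * ‖g (s⁻¹ * t)‖ * ω t ≤ ‖f s‖ * ‖g (s⁻¹ * t)‖ * (ω s * ω (s⁻¹ * t)) :=
        mul_le_mul_of_nonneg_left (weight_le s t) (by positivity)
    _ = _ := by ring

theorem summable_of_weight {ι : Type*} {u : ι → ℂ} (t : G)
    (h : Summable fun i => ‖u i‖ * ω t) : Summable u := by
  have h' : Summable fun i => ‖u i‖ := by
    have := h.mul_right (ω t)⁻¹
    simpa [mul_assoc, mul_inv_cancel₀ (ω.pos' t).ne'] using this
  exact h'.of_norm

theorem conv_summable_prod (f g : Beurling ω) :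
    Summable fun p : G × G => ‖f p.1 * g (p.1⁻¹ * p.2)‖ * ω p.2 :=
  Summable.of_nonneg_of_le (fun p => mul_nonneg (norm_nonneg _) (ω.pos' _).le)
    (fun p => conv_term_le f g p.1 p.2) (hasSum_prod f g).summable

theorem conv_summable (f g : Beurling ω) (t : G) : Summable fun s => f s * g (s⁻¹ * t) :=
  summable_of_weight (ω := ω) t
    ((conv_summable_prod f g).comp_injective (i := fun s => (s, t))
      fun _ _ h => (Prod.ext_iff.mp h).1)

theorem conv_norm_le (f g : Beurling ω) (t : G) :
    ‖∑' s, f s * g (s⁻¹ * t)‖ * ω t ≤ ∑' s, ‖f s * g (s⁻¹ * t)‖ * ω t := by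
  rw [tsum_mul_right]
  exact mul_le_mul_of_nonneg_right (norm_tsum_le_tsum_norm (conv_summable f g t).norm)
    (ω.pos' t).le

/-- Convolution: `(f * g)(t) = ∑ₛ f(s) g(s⁻¹ t)`. -/
def conv (f g : Beurling ω) : Beurling ω :=
  ⟨fun t => ∑' s, f s * g (s⁻¹ * t), by
    have h := (conv_summable_prod f g).prod_symm.prod
    exact Summable.of_nonneg_of_le (fun t => mul_nonneg (norm_nonneg _) (ω.pos' t).le)
      (fun t => conv_norm_le f g t) h⟩

theorem conv_apply (f g : Beurling ω) (t : G) : conv f g t = ∑' s, f s * g (s⁻¹ * t) := rfl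

theorem norm_conv_le (f g : Beurling ω) : ‖conv f g‖ ≤ ‖f‖ * ‖g‖ := by
  have h := (conv_summable_prod f g).prod_symm
  calc ‖conv f g‖ ≤ ∑' t, ∑' s, ‖f s * g (s⁻¹ * t)‖ * ω t :=
        (conv f g).summable.tsum_le_tsum (fun t => conv_norm_le f g t) h.prod
    _ = ∑' p : G × G, ‖f p.2 * g (p.2⁻¹ * p.1)‖ * ω p.1 := (h.tsum_prod).symm
    _ = ∑' p : G × G, ‖f p.1 * g (p.1⁻¹ * p.2)‖ * ω p.2 :=
        (Equiv.prodComm G G).tsum_eq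
          (fun p : G × G => ‖f p.1 * g (p.1⁻¹ * p.2)‖ * ω p.2)
    _ ≤ _ := (conv_summable_prod f g).tsum_le_tsum (fun p => conv_term_le f g p.1 p.2)
        (hasSum_prod f g).summable
    _ = ‖f‖ * ‖g‖ := (hasSum_prod f g).tsum_eq

theorem conv_assoc (f g h : Beurling ω) : conv (conv f g) h = conv f (conv g h) := by
  ext t
  have hs : Summable fun p : G × G => f p.1 * g (p.1⁻¹ * p.2) * h (p.2⁻¹ * t) := by
    refine summable_of_weight (ω := ω) t
      (Summable.of_nonneg_of_le (fun p => mul_nonneg (norm_nonneg _) (ω.pos' _).le)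
        (fun p => ?_) ((conv_summable_prod f g).mul_right ‖h‖))
    rw [norm_mul]
    calc ‖f p.1 * g (p.1⁻¹ * p.2)‖ * ‖h (p.2⁻¹ * t)‖ * ω t
        ≤ ‖f p.1 * g (p.1⁻¹ * p.2)‖ * ‖h (p.2⁻¹ * t)‖ * (ω p.2 * ω (p.2⁻¹ * t)) :=
          mul_le_mul_of_nonneg_left (weight_le _ t) (by positivity)
      _ = ‖f p.1 * g (p.1⁻¹ * p.2)‖ * ω p.2 * (‖h (p.2⁻¹ * t)‖ * ω (p.2⁻¹ * t)) := by ring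
      _ ≤ _ := mul_le_mul_of_nonneg_left (term_le_norm h _)
          (mul_nonneg (norm_nonneg _) (ω.pos' _).le)
  calc conv (conv f g) h t = ∑' s, ∑' r, f r * g (r⁻¹ * s) * h (s⁻¹ * t) := by
        simp only [conv_apply, tsum_mul_right]
    _ = ∑' r, ∑' s, f r * g (r⁻¹ * s) * h (s⁻¹ * t) := hs.tsum_comm
    _ = conv f (conv g h) t := by
        simp only [conv_apply]
        refine tsum_congr fun r => ?_
        rw [← (Equiv.mulLeft r).tsum_eq, ← tsum_mul_left]
        refine tsum_congr fun s => ?_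
        simp [mul_assoc]

open Classical in
variable (ω) in
/-- The point mass `δ_g`. -/
def delta (g : G) : Beurling ω :=
  ⟨fun t => if t = g then 1 else 0, by
    refine summable_of_ne_finset_zero (s := {g}) fun t ht => ?_
    rw [Finset.mem_singleton] at ht
    simp [ht]⟩

open Classical in
theorem delta_apply (g t : G) : delta ω g t = if t = g then 1 else 0 := rfl

theorem one_conv (f : Beurling ω) : conv (delta ω 1) f = f := by
  ext t
  rw [conv_apply, tsum_eq_single 1 (fun s hs => by simp [delta_apply, hs])]
  simp [delta_apply]

theorem conv_one (f : Beurling ω) : conv f (delta ω 1) = f := by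
  ext t
  rw [conv_apply, tsum_eq_single t (fun s hs => ?_)]
  · simp [delta_apply]
  · have : ¬ s⁻¹ * t = 1 := fun h => hs (inv_mul_eq_one.mp h)
    simp [delta_apply, this]

instance : NormedRing (Beurling ω) :=
  { (inferInstance : NormedAddCommGroup (Beurling ω)) with
    mul := conv
    one := delta ω 1
    left_distrib := fun f g h => by
      ext t
      change conv f (g + h) t = conv f g t + conv f h t
      simp only [conv_apply, add_apply, mul_add]
      exact (conv_summable f g t).tsum_add (conv_summable f h t)
    right_distrib := fun f g h => by
      ext t
      change conv (f + g) h t = conv f h t + conv g h t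
      simp only [conv_apply, add_apply, add_mul]
      exact (conv_summable f h t).tsum_add (conv_summable g h t)
    zero_mul := fun f => by
      ext t
      change conv 0 f t = 0
      simp [conv_apply]
    mul_zero := fun f => by
      ext t
      change conv f 0 t = 0
      simp [conv_apply]
    mul_assoc := conv_assoc
    one_mul := one_conv
    mul_one := conv_one
    norm_mul_le := norm_conv_le }

theorem mul_apply (f g : Beurling ω) (t : G) : (f * g) t = ∑' s, f s * g (s⁻¹ * t) := rfl

instance : NormedAlgebra ℂ (Beurling ω) :=
  { Algebra.ofModule
      (fun r f g => by
        ext t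
        simp only [mul_apply, smul_apply, mul_assoc, tsum_mul_left])
      (fun r f g => by
        ext t
        simp only [mul_apply, smul_apply, ← tsum_mul_left]
        exact tsum_congr fun s => by ring) with
    norm_smul_le := fun r f => norm_smul_le r f }

variable (ω) in
/-- The normalised point mass `δ_g / ω(g)`. -/
def normDelta (g : G) : Beurling ω := ((ω g : ℂ)⁻¹) • delta ω g

variable (ω) in
/-- The weight `ω`, as an element of the dual space `ℓ¹(G, ω)*`: `⟨ω, f⟩ = ∑ f(t) ω(t)`. -/
def weightFunctional : StrongDual ℂ (Beurling ω) :=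
  have hs : ∀ f : Beurling ω, Summable fun t => ‖f t * (ω t : ℂ)‖ := fun f => by
    simpa [abs_of_pos (ω.pos' _)] using f.summable
  LinearMap.mkContinuous
    { toFun := fun f => ∑' t, f t * (ω t : ℂ)
      map_add' := fun f g => by
        simp only [add_apply, add_mul]
        exact (hs f).of_norm.tsum_add (hs g).of_norm
      map_smul' := fun r f => by
        simp only [smul_apply, mul_assoc, tsum_mul_left, RingHom.id_apply, smul_eq_mul] }
    1 fun f => by
      rw [one_mul, norm_def]
      refine (norm_tsum_le_tsum_norm (hs f)).trans (le_of_eq (tsum_congr fun t => ?_))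
      simp [abs_of_pos (ω.pos' t)]

end Beurling

/-! ### Word lengths -/

/-- `T` generates `G` as a monoid. -/
def GeneratesAsMonoid (T : Set G) : Prop :=
  ∀ g : G, ∃ l : List G, (∀ x ∈ l, x ∈ T) ∧ l.prod = g

/-- The `T`-word length of `g`: the least length of a product of elements of `T` equal to `g`. -/
def wordLength (T : Set G) (g : G) : ℕ :=
  sInf {n | ∃ l : List G, l.length = n ∧ (∀ x ∈ l, x ∈ T) ∧ l.prod = g}

theorem wordLength_le {T : Set G} {l : List G} (hl : ∀ x ∈ l, x ∈ T) :
    wordLength T l.prod ≤ l.length := Nat.sInf_le ⟨l, rfl, hl, rfl⟩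

theorem GeneratesAsMonoid.exists_list {T : Set G} (hT : GeneratesAsMonoid T) (g : G) :
    ∃ l : List G, l.length = wordLength T g ∧ (∀ x ∈ l, x ∈ T) ∧ l.prod = g := by
  obtain ⟨l, hl, hg⟩ := hT g
  exact Nat.sInf_mem (s := {n | ∃ l : List G, l.length = n ∧ (∀ x ∈ l, x ∈ T) ∧ l.prod = g})
    ⟨l.length, l, rfl, hl, hg⟩

/-- The weight `g ↦ exp |g|_T`. -/
def wordWeight (T : Set G) (hT : GeneratesAsMonoid T) : Weight G where
  toFun := fun g => Real.exp (wordLength T g)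
  pos' := fun _ => Real.exp_pos _
  map_one' := by
    have h : wordLength T (1 : G) ≤ 0 := by
      simpa using wordLength_le (T := T) (l := []) (by simp)
    simp [Nat.le_zero.mp h]
  map_mul_le' := fun s t => by
    obtain ⟨l, hl, hlT, hs⟩ := hT.exists_list s
    obtain ⟨m, hm, hmT, ht⟩ := hT.exists_list t
    rw [← Real.exp_add]
    have h := wordLength_le (T := T) (l := l ++ m)
      (fun x hx => (List.mem_append.mp hx).elim (hlT x) (hmT x))
    rw [List.prod_append, hs, ht, List.length_append, hl, hm] at h
    exact Real.exp_le_exp.mpr (by exact_mod_cast h)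

/-! ### The weight on the free group on three generators -/

namespace FreeThree

/-- The free group on three generators `a`, `b`, `c`. -/
abbrev F3 : Type := FreeGroup (Fin 3)

/-- The first generator. -/
def a : F3 := FreeGroup.of 0
/-- The second generator. -/
def b : F3 := FreeGroup.of 1
/-- The third generator. -/
def c : F3 := FreeGroup.of 2

/-- The standard generating set. -/
def S : Set F3 := {a, b, c, a⁻¹, b⁻¹, c⁻¹}

/-- The elements `v b^(5^(2j-1)) v⁻¹ a^(5^(2j)) b^(5^(2j))` with `|v|_S ≤ 5^j`. -/
def Xlevel (j : ℕ) : Set F3 :=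
  {x | ∃ v : F3, wordLength S v ≤ 5 ^ j ∧
    x = v * b ^ (5 ^ (2 * j - 1)) * v⁻¹ * a ^ (5 ^ (2 * j)) * b ^ (5 ^ (2 * j))}

/-- The union of the sets `Xlevel j` over `j ≥ 2`, together with the standard generators. -/
def X : Set F3 := (⋃ j : ℕ, ⋃ _ : 2 ≤ j, Xlevel j) ∪ S

theorem generates_X : GeneratesAsMonoid X := by
  intro g
  induction g using FreeGroup.induction_on with
  | C1 => exact ⟨[], by simp, by simp⟩
  | of i =>
    refine ⟨[FreeGroup.of i], ?_, by simp⟩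
    simp only [List.mem_singleton, forall_eq]
    refine Or.inr ?_
    fin_cases i <;> simp [S, a, b, c]
  | inv_of i _ =>
    refine ⟨[(FreeGroup.of i)⁻¹], ?_, by simp⟩
    simp only [List.mem_singleton, forall_eq]
    refine Or.inr ?_
    fin_cases i <;> simp [S, a, b, c]
  | mul x y hx hy =>
    obtain ⟨l, hl, rfl⟩ := hx
    obtain ⟨m, hm, rfl⟩ := hy
    exact ⟨l ++ m, fun x hx => (List.mem_append.mp hx).elim (hl x) (hm x), by simp⟩

/-- The weight `ω(t) = exp |t|_X` on the free group. -/
def omega : Weight F3 := wordWeight X generates_X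

end FreeThree

end

noncomputable section

open Filter

/-! ### Reduced words in a free group. -/

namespace FreeGroup

variable {α : Type*}

/-! Let `π` be the endomorphism killing `c`, let `e_c` be the exponent sum of `c`, and put `h(g) =
exp(|π(g)|_X + e_c(g))`. Then `h ≤ ω` and `h(1) = 1`. Left multiplication by `c^n` multiplies `h` by
exactly `ω(c^n)`, and left multiplication by `x_m = a^(5^(2m)) b^(5^(2m))` multiplies it by exactly
`ω(x_m)` once `m` is large in terms of `g`. Hence `h`, as a functional, satisfies `h · Φ₀ = h` and
`h · Ψ₀ = h`, so `h · T = h` for `T = Φ₀ ◇ Ψ₀`, and every power of `T` takes the value `h(1) = 1` at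
`h`. These powers are positive contractions, so `h ≤ ω` and `‖ω‖ ≤ 1` squeeze their value at `ω` to
1 (`pow_apply_weightFunctional`). The powers then have norm at least 1, and the spectral radius of
`T` cannot vanish.

The combinatorial core is `eventually_wordLength_mul`: `|x_m g|_X = |x_m|_X + |g|_X` for large `m`.
With `K = 5^(2m-1)`, the cheap spelling of `x_m` is `b^(-K)` followed by the letter `b^K a^(5K)
b^(5K)`, of cost `K + 1`. A word for `x_m g` without letters of level at least `m` consists of short
steps but must pass near `a^(5K)`, where `6 e_a - 5 e_b`, which grows by at most 6 per letter, is
too large (`lt_length_of_norm_le`). If a letter of level at least `m` occurs, the exponent sum of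
`b` forces level `m`, and the rigidity of `a^(5K) b^(5K)` in `eq_one_of_mul_pow_mul_pow` forces what
follows it to spell `g` and what precedes it to have exponent sum `-K` in `b`
(`le_length_of_letter_mem`). -/

theorem _root_.List.IsPrefix.of_append {s l₁ l₂ : List α} (h : s <+: l₁ ++ l₂) :
    s <+: l₁ ∨ ∃ t, s = l₁ ++ t ∧ t <+: l₂ := by
  obtain ⟨r, hr⟩ := h
  rcases List.append_eq_append_iff.mp hr with ⟨t, h1, _⟩ | ⟨t, h1, h2⟩
  · exact Or.inl ⟨t, h1.symm⟩
  · exact Or.inr ⟨t, h1, r, h2.symm⟩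

/-- Undo one cancellation at a time: a prefix ending before the cancelled pair is already a prefix
upstairs, and one reaching past it becomes one after the pair is reinserted. -/
theorem exists_prefix_of_red {L L' s : List (α × Bool)} (h : Red L L') (hs : s <+: L') :
    ∃ L₁, L₁ <+: L ∧ mk L₁ = mk s := by
  induction h using Relation.ReflTransGen.head_induction_on with
  | refl => exact ⟨s, hs, rfl⟩
  | head hstep _ ih =>
    obtain ⟨L₁, hL₁, hm⟩ := ih
    rw [← hm]
    obtain @⟨A, B, x, b⟩ := hstep
    rcases hL₁.of_append with h | ⟨t, rfl, ht⟩
    · exact ⟨L₁, h.trans (List.prefix_append _ _), rfl⟩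
    · refine ⟨A ++ (x, b) :: (x, !b) :: t, ?_, ?_⟩
      · rw [List.prefix_append_right_inj, List.cons_prefix_cons, List.cons_prefix_cons]
        exact ⟨rfl, rfl, ht⟩
      · exact Quot.sound Red.Step.not

variable [DecidableEq α]

theorem mk_flatMap_toWord (l : List (FreeGroup α)) : mk (l.flatMap toWord) = l.prod := by
  induction l with
  | nil => rfl
  | cons x l ih => rw [List.flatMap_cons, ← mul_mk, ih, mk_toWord, List.prod_cons]

theorem exists_prefix_flatMap_toWord {B : ℕ} (l : List (FreeGroup α))
    (hB : ∀ x ∈ l, norm x ≤ B) (L : List (α × Bool)) (hL : L <+: l.flatMap toWord) :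
    ∃ l₁, l₁ <+: l ∧ ∃ t, mk L = l₁.prod * t ∧ norm t ≤ B := by
  induction l generalizing L with
  | nil =>
    rw [List.flatMap_nil, List.prefix_nil] at hL
    subst hL
    exact ⟨[], List.prefix_rfl, 1, rfl, by simp⟩
  | cons x l ih =>
    rw [List.flatMap_cons] at hL
    rcases hL.of_append with h | ⟨L', rfl, h⟩
    -- The prefix stops inside the first letter, so all of it is the error term `t`.
    · refine ⟨[], List.nil_prefix, mk L, by simp, norm_mk_le.trans (h.length_le.trans ?_)⟩
      exact hB x (by simp)
    · obtain ⟨l₁, hl, t, ht, htB⟩ := ih (fun y hy => hB y (by simp [hy])) L' h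
      refine ⟨x :: l₁, by simpa using hl, t, ?_, htB⟩
      rw [← mul_mk, ht, mk_toWord, List.prod_cons, mul_assoc]

/-- The path spelled by a list of group elements passes near every prefix of the reduced word of
its product. -/
theorem exists_prefix_prod_near {B : ℕ} (l : List (FreeGroup α)) (hB : ∀ x ∈ l, norm x ≤ B)
    (s : List (α × Bool)) (hs : s <+: toWord l.prod) :
    ∃ l₁, l₁ <+: l ∧ ∃ t, mk s = l₁.prod * t ∧ norm t ≤ B := by
  have hred : Red (l.flatMap toWord) (toWord l.prod) := by
    rw [← mk_flatMap_toWord, toWord_mk]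
    exact reduce.red
  obtain ⟨L, hL, hm⟩ := exists_prefix_of_red hred hs
  rw [← hm]
  exact exists_prefix_flatMap_toWord l hB L hL

/-- Multiplying on the left by one generator either prepends it or deletes the first symbol, so each
symbol of `q` destroys at most one symbol of `p`. -/
theorem drop_suffix_toWord_mul (q p : FreeGroup α) :
    (toWord p).drop (norm q) <:+ toWord (q * p) := by
  suffices h : ∀ L : List (α × Bool), (toWord p).drop L.length <:+ toWord (mk L * p) by
    simpa [norm, mk_toWord] using h (toWord q)
  intro L
  induction L with
  | nil => simp [← one_eq_mk]
  | cons x L ih =>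
    have e : mk (x :: L) * p = mk (x :: toWord (mk L * p)) := by
      have : x :: L = [x] ++ L := rfl
      rw [this, ← mul_mk, mul_assoc]
      conv_lhs => rw [← mk_toWord (x := mk L * p), mul_mk]
      rfl
    have htail : (toWord p).drop (x :: L).length <:+ (toWord (mk L * p)).tail := by
      rw [List.length_cons, ← List.drop_drop, List.drop_one]
      obtain ⟨t, ht⟩ := ih
      rw [← ht]
      cases t with
      | nil => exact List.suffix_rfl
      | cons y t =>
        exact (List.tail_suffix _).trans (List.suffix_append _ _)
    rw [e, toWord_mk, reduce.cons, reduce_toWord]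
    cases hw : toWord (mk L * p) with
    | nil =>
      rw [hw] at htail
      exact htail.trans List.nil_suffix
    | cons y t =>
      rw [hw, List.tail_cons] at htail
      dsimp only
      split_ifs
      · exact htail
      · exact htail.trans ((List.suffix_cons _ _).trans (List.suffix_cons _ _))

theorem take_prefix_toWord_mul (p q : FreeGroup α) :
    (toWord p).take (norm p - norm q) <+: toWord (p * q) := by
  -- Inversion reverses reduced words and turns the suffix statement into the prefix one.
  have h := drop_suffix_toWord_mul q⁻¹ p⁻¹
  rw [norm_inv_eq, ← mul_inv_rev, toWord_inv, toWord_inv] at h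
  obtain ⟨t, ht⟩ := h
  refine ⟨invRev t, ?_⟩
  have h2 := congrArg invRev ht
  rw [invRev_invRev, invRev_append] at h2
  rw [← h2]
  congr 1
  simp [invRev, List.drop_reverse, List.map_reverse, norm, List.map_take,
    List.map_map, Function.comp_def]

theorem toWord_pow_mul_pow (x y : α) (m n : ℕ) :
    toWord (of x ^ m * of y ^ n) = List.replicate m (x, true) ++ List.replicate n (y, true) := by
  rw [toWord_mul, toWord_of_pow, toWord_of_pow]
  refine IsReduced.reduce_eq ?_
  rw [IsReduced, List.isChain_append]
  refine ⟨?_, ?_, ?_⟩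
  · exact List.isChain_replicate_of_rel _ (by simp)
  · exact List.isChain_replicate_of_rel _ (by simp)
  · intro p hp q hq
    rw [List.eq_of_mem_replicate (List.mem_of_mem_getLast? hp),
      List.eq_of_mem_replicate (List.mem_of_mem_head? hq)]
    simp

/-- If `a ^ N b ^ N` is fixed up to small multipliers on both sides, then these are trivial. -/
theorem eq_one_of_mul_pow_mul_pow {x y : α} (hxy : x ≠ y) {N : ℕ} {u r : FreeGroup α}
    (hu : norm u < N) (hr : 2 * norm r < N)
    (h : u * (of x ^ N * of y ^ N) = of x ^ N * of y ^ N * r) : u = 1 ∧ r = 1 := by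
  suffices hu1 : u = 1 by
    refine ⟨hu1, ?_⟩
    rw [hu1, one_mul] at h
    exact (mul_eq_left.mp h.symm)
  have hw := toWord_pow_mul_pow x y N N
  set p := of x ^ N * of y ^ N with hp
  have hnorm : norm p = 2 * N := by simp [norm, hw]; ring
  have hpre := take_prefix_toWord_mul p r
  have hsuf := drop_suffix_toWord_mul u p
  rw [← h, hnorm] at hpre
  have hlen1 : norm (u * p) ≤ 2 * N + norm r := by
    rw [h, ← hnorm]; exact norm_mul_le _ _
  have hlen2 : 2 * N ≤ norm (u * p) + norm r := by
    have h2 := norm_mul_le (u * p) r⁻¹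
    rw [h, mul_inv_cancel_right, norm_inv_eq, hnorm] at h2
    rwa [h]
  -- `W` agrees with `p` from the left up to the last `norm r` symbols, and from the right up to the
  -- first `norm u` symbols. Both ranges see the unique change from `x` to `y`, so the two
  -- alignments cannot be shifted against each other.
  set W := toWord (u * p) with hW
  have hWl : W.length = norm (u * p) := rfl
  have hfst : ∀ i < 2 * N - norm r, W[i]? = (toWord p)[i]? := fun i hi => by
    obtain ⟨t, ht⟩ := hpre
    have hl : i < ((toWord p).take (2 * N - norm r)).length := by
      rw [List.length_take]
      have : (toWord p).length = 2 * N := hnorm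
      omega
    rw [← ht, List.getElem?_append_left hl, List.getElem?_take_of_lt hi]
  have hlst : ∀ i, norm u ≤ i → i < 2 * N → W[i + W.length - 2 * N]? = (toWord p)[i]? := by
    intro i hi hi2
    obtain ⟨t, ht⟩ := hsuf
    have hpl : (toWord p).length = 2 * N := hnorm
    have hl : t.length + (2 * N - norm u) = W.length := by
      rw [← ht, List.length_append, List.length_drop, hpl]
    rw [← ht, List.length_append, List.length_drop, hpl, List.getElem?_append_right (by omega),
      List.getElem?_drop]
    congr 1
    omega
  have hpx : ∀ i < N, (toWord p)[i]? = some (x, true) := fun i hi => by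
    rw [hw, List.getElem?_append_left (by simpa using hi)]
    simp [hi]
  have hpy : ∀ i, N ≤ i → i < 2 * N → (toWord p)[i]? = some (y, true) := fun i hi hi2 => by
    rw [hw, List.getElem?_append_right (by simpa using hi)]
    rw [List.getElem?_replicate, if_pos (by rw [List.length_replicate]; omega)]
  have hne : some (x, true) ≠ some (y, true) := by simpa using hxy
  have hL : W.length = 2 * N := by
    rcases lt_trichotomy W.length (2 * N) with hlt | heq | hgt
    · exfalso
      have h1 := hlst N hu.le (by omega)
      rw [hfst _ (by omega), hpx _ (by omega), hpy _ le_rfl (by omega)] at h1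
      exact hne h1
    · exact heq
    · exfalso
      -- The shift is at most `norm r`, so `2 * norm r < N` keeps the shifted position in the range
      -- of `hfst`.
      have h1 := hlst (N - 1) (by omega) (by omega)
      rw [hfst _ (by omega), hpy _ (by omega) (by omega), hpx _ (by omega)] at h1
      exact hne h1.symm
  have hWp : W = toWord p := by
    refine List.ext_getElem? fun i => ?_
    have hpl : (toWord p).length = 2 * N := hnorm
    rcases lt_or_ge i (2 * N - norm r) with h1 | h1
    · exact hfst i h1
    · rcases lt_or_ge i (2 * N) with h2 | h2
      · have := hlst i (by omega) h2
        rwa [hL, Nat.add_sub_cancel] at this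
      · rw [List.getElem?_eq_none (by omega), List.getElem?_eq_none (by omega)]
  exact mul_eq_right.mp (toWord_injective hWp)

end FreeGroup

/-! ### General facts on word length. -/

theorem wordLength_mul_le {G : Type*} [Group G] {T : Set G} (hT : GeneratesAsMonoid T) (s t : G) :
    wordLength T (s * t) ≤ wordLength T s + wordLength T t := by
  obtain ⟨l, hl, hlT, rfl⟩ := hT.exists_list s
  obtain ⟨m, hm, hmT, rfl⟩ := hT.exists_list t
  rw [← hl, ← hm, ← List.length_append, ← List.prod_append]
  exact wordLength_le fun x hx => (List.mem_append.mp hx).elim (hlT x) (hmT x)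

theorem wordLength_one {G : Type*} [Group G] (T : Set G) : wordLength T 1 = 0 :=
  Nat.le_zero.mp (wordLength_le (T := T) (l := []) (by simp))

theorem wordLength_le_one {G : Type*} [Group G] {T : Set G} {x : G} (hx : x ∈ T) :
    wordLength T x ≤ 1 := by
  simpa using wordLength_le (T := T) (l := [x]) (by simpa using hx)

/-! ### Exponent sums and the letters of `X`. -/

namespace FreeThree

open FreeGroup hiding map_mul map_inv

/-- The exponent sum of the generator `i`, as a homomorphism. -/
def expSumHom (i : Fin 3) : F3 →* Multiplicative ℤ :=
  FreeGroup.lift fun k => Multiplicative.ofAdd (if k = i then 1 else 0)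

/-- The exponent sum of the generator `i`. -/
def expSum (i : Fin 3) (g : F3) : ℤ := (expSumHom i g).toAdd

@[simp] theorem expSum_one (i : Fin 3) : expSum i 1 = 0 := by simp [expSum]

@[simp] theorem expSum_mul (i : Fin 3) (g h : F3) :
    expSum i (g * h) = expSum i g + expSum i h := by simp [expSum]

@[simp] theorem expSum_inv (i : Fin 3) (g : F3) : expSum i g⁻¹ = -expSum i g := by simp [expSum]

@[simp] theorem expSum_pow (i : Fin 3) (g : F3) (n : ℕ) : expSum i (g ^ n) = n * expSum i g := by
  simp [expSum]

@[simp] theorem expSum_a (i : Fin 3) : expSum i a = if 0 = i then 1 else 0 := by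
  simp [expSum, expSumHom, a]

@[simp] theorem expSum_b (i : Fin 3) : expSum i b = if 1 = i then 1 else 0 := by
  simp [expSum, expSumHom, b]

@[simp] theorem expSum_c (i : Fin 3) : expSum i c = if 2 = i then 1 else 0 := by
  simp [expSum, expSumHom, c]

theorem abs_expSum_mk_le (i : Fin 3) (L : List (Fin 3 × Bool)) :
    |expSum i (mk L)| ≤ L.length := by
  induction L with
  | nil => simp [← one_eq_mk]
  | cons x L ih =>
    have h : mk (x :: L) = mk [x] * mk L := by rw [mul_mk]; rfl
    have hx : |expSum i (mk [x])| ≤ 1 := by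
      rcases x with ⟨k, _ | _⟩ <;> by_cases hk : k = i <;> simp [expSum, expSumHom, hk]
    rw [h, expSum_mul, List.length_cons]
    push_cast
    linarith [abs_add_le (expSum i (mk [x])) (expSum i (mk L))]

theorem abs_expSum_le (i : Fin 3) (g : F3) : |expSum i g| ≤ FreeGroup.norm g := by
  simpa [FreeGroup.norm, mk_toWord] using abs_expSum_mk_le i (toWord g)

theorem generates_S : GeneratesAsMonoid S := by
  intro g
  induction g using FreeGroup.induction_on with
  | C1 => exact ⟨[], by simp, by simp⟩
  | of i =>
    refine ⟨[FreeGroup.of i], ?_, by simp⟩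
    simp only [List.mem_singleton, forall_eq]
    fin_cases i <;> simp [S, a, b, c]
  | inv_of i _ =>
    refine ⟨[(FreeGroup.of i)⁻¹], ?_, by simp⟩
    simp only [List.mem_singleton, forall_eq]
    fin_cases i <;> simp [S, a, b, c]
  | mul x y hx hy =>
    obtain ⟨l, hl, rfl⟩ := hx
    obtain ⟨m, hm, rfl⟩ := hy
    exact ⟨l ++ m, fun x hx => (List.mem_append.mp hx).elim (hl x) (hm x), by simp⟩

theorem norm_prod_le_of_subset_S (l : List F3) (hl : ∀ x ∈ l, x ∈ S) : FreeGroup.norm l.prod ≤ l.length := by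
  induction l with
  | nil => simp
  | cons x l ih =>
    have hx : FreeGroup.norm x ≤ 1 := by
      rcases hl x (by simp) with h | h | h | h | h | h <;> subst h <;>
        simp [a, b, c, norm_inv_eq, norm_of]
    rw [List.prod_cons, List.length_cons]
    have := ih fun y hy => hl y (by simp [hy])
    have := norm_mul_le x l.prod
    omega

theorem norm_le_wordLength_S (g : F3) : FreeGroup.norm g ≤ wordLength S g := by
  obtain ⟨l, hl, hlS, rfl⟩ := generates_S.exists_list g
  rw [← hl]
  exact norm_prod_le_of_subset_S l hlS

/-- The element `v b^K v⁻¹ a^(5K) b^(5K)`. -/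
def letter (K : ℕ) (v : F3) : F3 := v * b ^ K * v⁻¹ * a ^ (5 * K) * b ^ (5 * K)

theorem five_pow_two_mul {j : ℕ} (hj : 1 ≤ j) : 5 ^ (2 * j) = 5 * 5 ^ (2 * j - 1) := by
  rw [← pow_succ']
  congr 1
  omega

theorem five_mul_five_pow_le {j : ℕ} (hj : 2 ≤ j) : 5 * 5 ^ j ≤ 5 ^ (2 * j - 1) := by
  rw [← pow_succ']
  exact Nat.pow_le_pow_right (by norm_num) (by omega)

theorem mem_X_iff {x : F3} :
    x ∈ X ↔ (∃ j, 2 ≤ j ∧ ∃ v, FreeGroup.norm v ≤ 5 ^ j ∧ wordLength S v ≤ 5 ^ j ∧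
      x = letter (5 ^ (2 * j - 1)) v) ∨ x ∈ S := by
  rw [X, Set.mem_union]
  refine or_congr_left ?_
  simp only [Set.mem_iUnion, exists_prop, Xlevel, Set.mem_ofPred_eq]
  refine exists_congr fun j => and_congr_right fun hj => exists_congr fun v => ?_
  rw [letter, ← five_pow_two_mul (by omega)]
  exact ⟨fun h => ⟨(norm_le_wordLength_S v).trans h.1, h⟩, fun h => h.2⟩

@[simp] theorem expSum_zero_letter (K : ℕ) (v : F3) : expSum 0 (letter K v) = 5 * K := by
  simp [letter]

@[simp] theorem expSum_one_letter (K : ℕ) (v : F3) : expSum 1 (letter K v) = 6 * K := by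
  simp [letter]; ring

@[simp] theorem expSum_two_letter (K : ℕ) (v : F3) : expSum 2 (letter K v) = 0 := by
  simp [letter]

theorem norm_letter_le (K : ℕ) (v : F3) : FreeGroup.norm (letter K v) ≤ 2 * FreeGroup.norm v + 11 * K := by
  have h1 := norm_mul_le (v * b ^ K * v⁻¹ * a ^ (5 * K)) (b ^ (5 * K))
  have h2 := norm_mul_le (v * b ^ K * v⁻¹) (a ^ (5 * K))
  have h3 := norm_mul_le (v * b ^ K) v⁻¹
  have h4 := norm_mul_le v (b ^ K)
  rw [b, norm_of_pow] at *
  rw [a, norm_of_pow] at *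
  rw [norm_inv_eq] at h3
  rw [letter, b, a]
  omega

/-- Three linear inequalities that add up along words over `X`. In the last one a long letter
contributes `6 * 5K - 5 * 6K = 0`. In the first, its norm is at most `2 * 5^j + 11K`, well below
`18K`, while `b⁻¹` gives equality. -/
theorem expSum_of_mem_X {x : F3} (hx : x ∈ X) :
    (FreeGroup.norm x : ℤ) ≤ 3 * expSum 1 x + 4 ∧ -1 ≤ expSum 1 x ∧ 6 * expSum 0 x - 5 * expSum 1 x ≤ 6 := by
  rcases mem_X_iff.mp hx with ⟨j, hj, v, hv, -, rfl⟩ | hx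
  · have h1 := norm_letter_le (5 ^ (2 * j - 1)) v
    have h2 := five_mul_five_pow_le hj
    rw [expSum_zero_letter, expSum_one_letter]
    zify at *
    refine ⟨?_, ?_, ?_⟩ <;> linarith
  · rcases hx with h | h | h | h | h | h <;> subst h <;>
      simp [norm_inv_eq] <;> simp [a, b, c, norm_of]

theorem expSum_prod_of_subset_X (l : List F3) (hl : ∀ x ∈ l, x ∈ X) :
    (FreeGroup.norm l.prod : ℤ) ≤ 3 * expSum 1 l.prod + 4 * l.length ∧ -(l.length : ℤ) ≤ expSum 1 l.prod ∧
      6 * expSum 0 l.prod - 5 * expSum 1 l.prod ≤ 6 * l.length := by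
  induction l with
  | nil => simp
  | cons x l ih =>
    obtain ⟨h1, h2, h3⟩ := ih fun y hy => hl y (by simp [hy])
    obtain ⟨h4, h5, h6⟩ := expSum_of_mem_X (hl x (by simp))
    have h7 := norm_mul_le x l.prod
    zify at h7
    rw [List.prod_cons, List.length_cons, expSum_mul, expSum_mul]
    push_cast
    refine ⟨?_, ?_, ?_⟩ <;> linarith

/-! ### Length of words for `a^(5K) b^(5K) g`. -/

/-- A word over `X` for `a^(5K) b^(5K) g` that contains a long letter of level at least `m`. -/
theorem le_length_of_letter_mem {m j : ℕ} (hm : 2 ≤ m) (hj : m ≤ j) {g v : F3} {l₁ l₂ : List F3}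
    (hK : 20 * (FreeGroup.norm g + wordLength X g + 1) ≤ 5 ^ (2 * m - 1)) (hv : FreeGroup.norm v ≤ 5 ^ j)
    (hl₁ : ∀ x ∈ l₁, x ∈ X) (hl₂ : ∀ x ∈ l₂, x ∈ X)
    (hlen : l₁.length + l₂.length ≤ 5 ^ (2 * m - 1) + wordLength X g)
    (hprod : l₁.prod * letter (5 ^ (2 * j - 1)) v * l₂.prod =
      a ^ (5 * 5 ^ (2 * m - 1)) * b ^ (5 * 5 ^ (2 * m - 1)) * g) :
    5 ^ (2 * m - 1) + wordLength X g ≤ l₁.length + l₂.length := by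
  have hsum := congrArg (expSum 1) hprod
  obtain ⟨n1, p1, -⟩ := expSum_prod_of_subset_X l₁ hl₁
  obtain ⟨n2, p2, -⟩ := expSum_prod_of_subset_X l₂ hl₂
  have hg := abs_le.mp (abs_expSum_le 1 g)
  -- A higher level would contribute at least `150K` to the exponent sum of `b`. The remaining
  -- letters each remove at most 1, and the target is only `5K` plus that of `g`.
  have hjm : j = m := by
    by_contra hne
    have h25 : 25 * 5 ^ (2 * m - 1) ≤ 5 ^ (2 * j - 1) := by
      calc 25 * 5 ^ (2 * m - 1) = 5 ^ (2 * m - 1 + 2) := by rw [pow_add]; ring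
        _ ≤ _ := Nat.pow_le_pow_right (by norm_num) (by omega)
    simp only [expSum_mul, expSum_one_letter, expSum_pow, expSum_a, expSum_b] at hsum
    zify at *
    simp at hsum
    linarith [hg.1, hg.2]
  subst hjm
  have h5 := five_mul_five_pow_le hm
  set K := 5 ^ (2 * j - 1) with hKdef
  simp only [expSum_mul, expSum_one_letter, expSum_pow, expSum_a, expSum_b] at hsum
  simp at hsum
  -- Peel `a^(5K) b^(5K)` off the long letter, so that both sides contain the same block up to
  -- multipliers that are short compared with `5K`.
  have heq : (l₁.prod * (v * b ^ K * v⁻¹)) * (a ^ (5 * K) * b ^ (5 * K)) =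
      a ^ (5 * K) * b ^ (5 * K) * (g * l₂.prod⁻¹) := by
    rw [← mul_assoc _ g, ← hprod, letter]
    group
  have hu : FreeGroup.norm (l₁.prod * (v * b ^ K * v⁻¹)) ≤ FreeGroup.norm l₁.prod + (2 * FreeGroup.norm v + K) := by
    have h1 := norm_mul_le l₁.prod (v * b ^ K * v⁻¹)
    have h3 := norm_mul_le (v * b ^ K) v⁻¹
    have h4 := norm_mul_le v (b ^ K)
    rw [norm_inv_eq] at h3
    rw [show FreeGroup.norm (b ^ K) = K from norm_of_pow _ _] at h4
    omega
  have hr : FreeGroup.norm (g * l₂.prod⁻¹) ≤ FreeGroup.norm g + FreeGroup.norm l₂.prod := by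
    simpa [norm_inv_eq] using norm_mul_le g l₂.prod⁻¹
  -- The `b`-exponents of the two flanks sum to that of `g` minus `K`; with at most `K + |g|_X`
  -- letters, the bound `3 e_b + 4 * length` leaves about `4K - 3K`.
  have hn : FreeGroup.norm l₁.prod + FreeGroup.norm l₂.prod ≤ K + 3 * FreeGroup.norm g + 4 * wordLength X g := by
    zify at *
    linarith [hg.1, hg.2]
  obtain ⟨h1, h2⟩ := eq_one_of_mul_pow_mul_pow (x := (0 : Fin 3)) (y := 1) (by decide)
    (by omega) (by omega) heq
  -- Since `l₁.prod` is inverse to a conjugate of `b^K`, its exponent sum in `b` is `-K`, which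
  -- needs at least `K` letters.
  have hs1 := congrArg (expSum 1) h1
  simp at hs1
  have hg2 : l₂.prod = g := (mul_inv_eq_one.mp h2).symm
  have := wordLength_le (T := X) hl₂
  rw [hg2] at this
  omega

/-- A word over `X` for `a^(5K) b^(5K) g` without long letters of level at least `m`. -/
theorem lt_length_of_norm_le {K : ℕ} {g : F3} {l : List F3} {G : ℕ}
    (hK : 20 * (FreeGroup.norm g + G + 1) ≤ K) (hl : ∀ x ∈ l, x ∈ X)
    (hB : ∀ x ∈ l, FreeGroup.norm x ≤ K) (hprod : l.prod = a ^ (5 * K) * b ^ (5 * K) * g) :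
    K + G < l.length := by
  have hp : toWord (a ^ (5 * K) * b ^ (5 * K)) = _ := toWord_pow_mul_pow 0 1 (5 * K) (5 * K)
  have hpre := take_prefix_toWord_mul (a ^ (5 * K) * b ^ (5 * K)) g
  rw [← hprod] at hpre
  have hs : List.replicate (5 * K) ((0 : Fin 3), true) <+: toWord l.prod := by
    refine List.IsPrefix.trans ?_ hpre
    rw [List.prefix_take_iff, hp]
    refine ⟨List.prefix_append _ _, ?_⟩
    rw [FreeGroup.norm, hp]
    simp
    omega
  -- Some partial product is within `K` of `a^(5K)`. There `6 e_a - 5 e_b ≥ 6 * 4K - 5K = 19K`, so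
  -- more than `3K` letters have been used.
  obtain ⟨l₁, hl₁, t, ht, htK⟩ := exists_prefix_prod_near l hB _ hs
  have ha : mk (List.replicate (5 * K) ((0 : Fin 3), true)) = a ^ (5 * K) := by
    rw [← toWord_of_pow, mk_toWord, a]
  rw [ha] at ht
  obtain ⟨-, -, h⟩ := expSum_prod_of_subset_X l₁ fun x hx => hl x (hl₁.subset hx)
  have h0 := congrArg (expSum 0) ht
  have h1 := congrArg (expSum 1) ht
  simp at h0 h1
  have t0 := abs_le.mp (abs_expSum_le 0 t)
  have t1 := abs_le.mp (abs_expSum_le 1 t)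
  have := hl₁.length_le
  zify at *
  linarith [t0.1, t0.2, t1.1, t1.2]

/-- Consecutive levels differ by a factor 25 in `K`, while a letter has norm less than `12K` for its
own `K`; hence lower-level letters are short on the scale of level `m`. -/
theorem norm_le_of_mem_X {m : ℕ} {x : F3} (hx : x ∈ X)
    (h : ∀ j v, m ≤ j → FreeGroup.norm v ≤ 5 ^ j → x ≠ letter (5 ^ (2 * j - 1)) v) :
    FreeGroup.norm x ≤ 5 ^ (2 * m - 1) := by
  rcases mem_X_iff.mp hx with ⟨j, hj, v, hv, -, rfl⟩ | hx
  · have hjm : j < m := not_le.mp fun hle => h j v hle hv rfl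
    have h1 := norm_letter_le (5 ^ (2 * j - 1)) v
    have h2 := five_mul_five_pow_le hj
    have h25 : 25 * 5 ^ (2 * j - 1) ≤ 5 ^ (2 * m - 1) := by
      calc 25 * 5 ^ (2 * j - 1) = 5 ^ (2 * j - 1 + 2) := by rw [pow_add]; ring
        _ ≤ _ := Nat.pow_le_pow_right (by norm_num) (by omega)
    omega
  · have h1 : FreeGroup.norm x ≤ 1 := by
      rcases hx with h | h | h | h | h | h <;> subst h <;> simp [a, b, c, norm_inv_eq, norm_of]
    exact h1.trans (Nat.one_le_pow _ _ (by norm_num))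

theorem le_wordLength_mul {m : ℕ} (hm : 2 ≤ m) {g : F3}
    (hK : 20 * (FreeGroup.norm g + wordLength X g + 1) ≤ 5 ^ (2 * m - 1)) :
    5 ^ (2 * m - 1) + 1 + wordLength X g ≤
      wordLength X (a ^ (5 ^ (2 * m)) * b ^ (5 ^ (2 * m)) * g) := by
  obtain ⟨l, hl, hlX, hprod⟩ := generates_X.exists_list (a ^ (5 ^ (2 * m)) * b ^ (5 ^ (2 * m)) * g)
  rw [← hl]
  by_contra! hlt
  rw [five_pow_two_mul (by omega)] at hprod
  by_cases hB : ∀ x ∈ l, FreeGroup.norm x ≤ 5 ^ (2 * m - 1)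
  · have := lt_length_of_norm_le hK hlX hB hprod
    omega
  · push Not at hB
    obtain ⟨x, hxl, hx⟩ := hB
    have : ∃ j v, m ≤ j ∧ FreeGroup.norm v ≤ 5 ^ j ∧ x = letter (5 ^ (2 * j - 1)) v := by
      by_contra! hcon
      exact absurd (norm_le_of_mem_X (hlX x hxl) hcon) (not_le.mpr hx)
    obtain ⟨j, v, hj, hv, rfl⟩ := this
    obtain ⟨l₁, l₂, rfl⟩ := List.append_of_mem hxl
    rw [List.length_append, List.length_cons] at hlt
    have := le_length_of_letter_mem (l₁ := l₁) (l₂ := l₂) hm hj hK hv (fun y hy => hlX y (by simp [hy]))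
      (fun y hy => hlX y (by simp [hy])) (by omega)
      (by rw [← hprod, List.prod_append, List.prod_cons]; group)
    omega

theorem wordLength_le_of_two_le {m : ℕ} (hm : 2 ≤ m) :
    wordLength X (a ^ (5 ^ (2 * m)) * b ^ (5 ^ (2 * m))) ≤ 5 ^ (2 * m - 1) + 1 := by
  have h := wordLength_le (T := X)
    -- The letter with trivial `v` starts with an unwanted `b^K`, removed by `K` copies of `b⁻¹`.
    (l := List.replicate (5 ^ (2 * m - 1)) b⁻¹ ++ [letter (5 ^ (2 * m - 1)) 1]) (fun x hx => by
      rcases List.mem_append.mp hx with h | h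
      · rw [List.eq_of_mem_replicate h]
        exact Or.inr (by simp [S])
      · rw [List.mem_singleton.mp h]
        exact mem_X_iff.mpr (Or.inl ⟨m, hm, 1, by simp, by simp [wordLength_one], rfl⟩))
  simpa [letter, five_pow_two_mul (show 1 ≤ m by omega), mul_assoc] using h

/-- The lower bound for the product exceeds the upper bound for the first factor by exactly `|g|_X`;
subadditivity gives the converse. -/
theorem eventually_wordLength_mul (g : F3) : ∀ᶠ m in atTop,
    wordLength X (a ^ (5 ^ (2 * m)) * b ^ (5 ^ (2 * m)) * g) =
      wordLength X (a ^ (5 ^ (2 * m)) * b ^ (5 ^ (2 * m))) + wordLength X g := by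
  filter_upwards [eventually_ge_atTop (20 * (FreeGroup.norm g + wordLength X g + 1) + 2)] with m hm
  have h1 : m ≤ 5 ^ (2 * m - 1) :=
    ((Nat.lt_pow_self (by norm_num)).le).trans
      (Nat.pow_le_pow_right (n := 5) (by norm_num) (show m ≤ 2 * m - 1 by omega))
  have h2 := le_wordLength_mul (m := m) (g := g) (by omega) (by omega)
  have h3 := wordLength_le_of_two_le (m := m) (by omega)
  exact le_antisymm (wordLength_mul_le generates_X _ _) (by omega)

/-! ### Killing the generator `c`. -/

/-- The endomorphism of the free group that kills the third generator. -/
def killC : F3 →* F3 := FreeGroup.lift ![a, b, 1]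

@[simp] theorem killC_a : killC a = a := by simp [killC, a]
@[simp] theorem killC_b : killC b = b := by simp [killC, b]
@[simp] theorem killC_c : killC c = 1 := by simp [killC, c]

theorem wordLength_S_killC_le (g : F3) : wordLength S (killC g) ≤ wordLength S g := by
  obtain ⟨l, hl, hlS, rfl⟩ := generates_S.exists_list g
  rw [← hl]
  clear hl
  induction l with
  | nil => simp [wordLength_one]
  | cons x l ih =>
    have hx : wordLength S (killC x) ≤ 1 := by
      rcases hlS x (by simp) with h | h | h | h | h | h <;> subst h <;>
        simp only [map_inv, killC_a, killC_b, killC_c, inv_one, wordLength_one, zero_le] <;>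
        exact wordLength_le_one (by simp [S])
    have := ih fun y hy => hlS y (by simp [hy])
    have := wordLength_mul_le generates_S (killC x) (killC l.prod)
    rw [List.prod_cons, map_mul, List.length_cons]
    omega

/-- Killing `c` does not lengthen `v`, so each long letter is sent to a letter of the same level,
with no `c`-exponent. The generator `c` loses its length but gains exponent 1. -/
theorem wordLength_killC_add_le_one {x : F3} (hx : x ∈ X) :
    (wordLength X (killC x) : ℤ) + expSum 2 x ≤ 1 := by
  rcases mem_X_iff.mp hx with ⟨j, hj, v, -, hv, rfl⟩ | hx
  · have h : killC (letter (5 ^ (2 * j - 1)) v) ∈ X := by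
      have hv' := (wordLength_S_killC_le v).trans hv
      exact mem_X_iff.mpr (Or.inl ⟨j, hj, killC v, (norm_le_wordLength_S _).trans hv', hv',
        by simp [letter]⟩)
    have := wordLength_le_one h
    rw [expSum_two_letter]
    omega
  · rcases hx with h | h | h | h | h | h <;> subst h <;>
      simp [wordLength_one] <;> exact wordLength_le_one (Or.inr (by simp [S]))

theorem wordLength_killC_add_le (g : F3) :
    (wordLength X (killC g) : ℤ) + expSum 2 g ≤ wordLength X g := by
  obtain ⟨l, hl, hlX, rfl⟩ := generates_X.exists_list g
  rw [← hl]
  clear hl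
  induction l with
  | nil => simp [wordLength_one]
  | cons x l ih =>
    have h1 := wordLength_killC_add_le_one (hlX x (by simp))
    have h2 := ih fun y hy => hlX y (by simp [hy])
    have h3 := wordLength_mul_le generates_X (killC x) (killC l.prod)
    rw [List.prod_cons, map_mul, List.length_cons, expSum_mul]
    zify at h3
    push_cast
    linarith

theorem wordLength_c_pow (n : ℕ) : wordLength X (c ^ n) = n := by
  refine le_antisymm ?_ ?_
  · have h := wordLength_le (T := X) (l := List.replicate n c)
      (fun x hx => by rw [List.eq_of_mem_replicate hx]; exact Or.inr (by simp [S]))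
    simpa using h
  · have h := wordLength_killC_add_le (c ^ n)
    simp [wordLength_one] at h
    exact h

end FreeThree

/-! ### Weak*-accumulation points and quasi-nilpotence. -/

namespace Arens

variable {A : Type*} [NormedRing A] [NormedAlgebra ℂ A] {u : ℕ → A}
  {Φ : StrongDual ℂ (StrongDual ℂ A)}

theorem IsWeakStarAccPt.mapClusterPt_apply (h : IsWeakStarAccPt u Φ) (φ : StrongDual ℂ A) :
    MapClusterPt (Φ φ) atTop fun n => φ (u n) :=
  h.continuousAt_comp (f := fun Ψ : WeakDual ℂ (StrongDual ℂ A) => Ψ φ)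
    (WeakDual.eval_continuous φ).continuousAt

theorem IsWeakStarAccPt.apply_eq_of_tendsto (h : IsWeakStarAccPt u Φ) {φ : StrongDual ℂ A} {z : ℂ}
    (hz : Tendsto (fun n => φ (u n)) atTop (nhds z)) : Φ φ = z := by
  have : NeBot (nhds (Φ φ) ⊓ nhds z) :=
    Filter.NeBot.mono (h.mapClusterPt_apply φ) (inf_le_inf_left _ hz)
  exact eq_of_nhds_neBot this

theorem IsWeakStarAccPt.apply_mem_of_isClosed (h : IsWeakStarAccPt u Φ) {φ : StrongDual ℂ A}
    {C : Set ℂ} (hC : IsClosed C) (hu : ∀ n, φ (u n) ∈ C) : Φ φ ∈ C := by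
  by_contra hne
  obtain ⟨n, hn⟩ := ((h.mapClusterPt_apply φ).frequently (hC.isOpen_compl.mem_nhds hne)).exists
  exact hn (hu n)

theorem IsWeakStarAccPt.norm_le_one (h : IsWeakStarAccPt u Φ) (hu : ∀ n, ‖u n‖ ≤ 1) : ‖Φ‖ ≤ 1 := by
  refine Φ.opNorm_le_bound zero_le_one fun φ => ?_
  rw [one_mul]
  have := h.apply_mem_of_isClosed (φ := φ) (C := Metric.closedBall 0 ‖φ‖) Metric.isClosed_closedBall
    fun n => by
      rw [mem_closedBall_zero_iff]
      exact (φ.le_opNorm _).trans (mul_le_of_le_one_right (norm_nonneg _) (hu n))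
  rwa [mem_closedBall_zero_iff] at this

/-- An element with powers bounded away from zero is not quasi-nilpotent. -/
theorem not_isQuasiNilpotent_of_le_norm_pow {B : Type*} [NormedRing B] [NormedAlgebra ℂ B]
    [CompleteSpace B] {x : B} (h : ∀ n : ℕ, 1 ≤ ‖x ^ n‖) : ¬ IsQuasiNilpotent x := by
  intro hx
  have h0 : spectralRadius ℂ x = 0 := by
    rw [spectralRadius, show spectrum ℂ x = {0} from hx]
    simp
  have hlim := spectrum.pow_nnnorm_pow_one_div_tendsto_nhds_spectralRadius x
  rw [h0] at hlim
  refine absurd (ge_of_tendsto' (b := 1) hlim fun n => ?_) (by simp)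
  rw [← ENNReal.one_rpow (1 / (n : ℝ))]
  exact ENNReal.rpow_le_rpow (by exact_mod_cast h n) (by positivity)

end Arens

/-! ### Functionals on Beurling algebras and positivity. -/

namespace Beurling

variable {G : Type*} [Group G] {ω : Weight G}

theorem hasSum_smul_delta (f : Beurling ω) : HasSum (fun t => f t • delta ω t) f := by
  classical
  have happ : ∀ (s : Finset G) (t : G),
      (∑ x ∈ s, f x • delta ω x) t = if t ∈ s then f t else 0 := by
    intro s t
    induction s using Finset.induction_on with
    | empty => simp
    | insert x s hx ih =>
      rw [Finset.sum_insert hx, add_apply, ih, smul_apply, delta_apply]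
      by_cases htx : t = x
      · subst htx; simp [hx]
      · simp [htx]
  rw [HasSum, SummationFilter.unconditional_filter, tendsto_iff_norm_sub_tendsto_zero]
  have h := tendsto_tsum_compl_atTop_zero fun t => ‖f t‖ * ω t
  refine h.congr fun s => ?_
  rw [norm_def]
  refine (tsum_subtype {x | x ∉ s} fun t => ‖f t‖ * ω t).trans ?_
  refine tsum_congr fun t => ?_
  rw [sub_eq_add_neg, add_apply, neg_apply, happ]
  by_cases ht : t ∈ s <;> simp [ht]

/-- Bounded functionals that agree on point masses are equal. -/
theorem dual_ext {φ ψ : StrongDual ℂ (Beurling ω)} (h : ∀ t, φ (delta ω t) = ψ (delta ω t)) :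
    φ = ψ := by
  ext f
  refine ((hasSum_smul_delta f).mapL φ).unique ?_
  simpa [h] using (hasSum_smul_delta f).mapL ψ

theorem delta_mul_delta (s t : G) : delta ω s * delta ω t = delta ω (s * t) := by
  ext r
  rw [mul_apply, tsum_eq_single s fun x hx => by simp [delta_apply, hx]]
  simp only [delta_apply, if_true, one_mul]
  classical exact if_congr inv_mul_eq_iff_eq_mul rfl rfl

theorem normDelta_mul_delta (s t : G) :
    normDelta ω s * delta ω t = ((ω s : ℂ)⁻¹) • delta ω (s * t) := by
  rw [normDelta, smul_mul_assoc, delta_mul_delta]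

theorem norm_normDelta (t : G) : ‖normDelta ω t‖ = 1 := by
  have h := ω.pos' t
  rw [normDelta, norm_smul, norm_def, tsum_eq_single t fun x hx => by simp [delta_apply, hx]]
  simp [delta_apply, abs_of_pos h, h.ne']

/-- The bounded functional `f ↦ ∑ f(t) k(t)` given by a function `k` with `|k| ≤ ω`. -/
def functionalOfLe (k : G → ℝ) (hk : ∀ t, |k t| ≤ ω t) : StrongDual ℂ (Beurling ω) :=
  have hle : ∀ (f : Beurling ω) t, ‖f t * (k t : ℂ)‖ ≤ ‖f t‖ * ω t := fun f t => by
    rw [norm_mul, Complex.norm_real, Real.norm_eq_abs]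
    exact mul_le_mul_of_nonneg_left (hk t) (norm_nonneg _)
  have hs : ∀ f : Beurling ω, Summable fun t => ‖f t * (k t : ℂ)‖ := fun f =>
    f.summable.of_nonneg_of_le (fun _ => norm_nonneg _) (hle f)
  LinearMap.mkContinuous
    { toFun := fun f => ∑' t, f t * (k t : ℂ)
      map_add' := fun f g => by
        simp only [add_apply, add_mul]
        exact (hs f).of_norm.tsum_add (hs g).of_norm
      map_smul' := fun r f => by
        simp only [smul_apply, mul_assoc, tsum_mul_left, RingHom.id_apply, smul_eq_mul] }
    1 fun f => by
      rw [one_mul, norm_def]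
      exact (norm_tsum_le_tsum_norm (hs f)).trans ((hs f).tsum_le_tsum (hle f) f.summable)

@[simp] theorem functionalOfLe_delta (k : G → ℝ) (hk : ∀ t, |k t| ≤ ω t) (t : G) :
    functionalOfLe k hk (delta ω t) = k t := by
  change ∑' s, delta ω t s * (k s : ℂ) = k t
  rw [tsum_eq_single t fun x hx => by simp [delta_apply, hx]]
  simp [delta_apply]

@[simp] theorem weightFunctional_delta (t : G) : weightFunctional ω (delta ω t) = ω t := by
  change ∑' s, delta ω t s * (ω s : ℂ) = ω t
  rw [tsum_eq_single t fun x hx => by simp [delta_apply, hx]]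
  simp [delta_apply]

theorem norm_weightFunctional_le : ‖weightFunctional ω‖ ≤ 1 :=
  (weightFunctional ω).opNorm_le_bound zero_le_one fun f => by
    have h : ∀ t, ‖f t * (ω t : ℂ)‖ = ‖f t‖ * ω t := fun t => by simp [abs_of_pos (ω.pos' t)]
    rw [one_mul, norm_def]
    simp only [← h]
    exact norm_tsum_le_tsum_norm (by simpa only [h] using f.summable)

open Arens ComplexOrder

/-- A weak*-accumulation point of normalised point masses fixes a functional that is asymptotically
multiplicative against them. -/
theorem ract_eq_self_of_tendsto {x : ℕ → G} {Φ : StrongDual ℂ (StrongDual ℂ (Beurling ω))}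
    (hΦ : IsWeakStarAccPt (fun n => normDelta ω (x n)) Φ) (φ : StrongDual ℂ (Beurling ω))
    (h : ∀ t, Tendsto (fun n => (ω (x n) : ℂ)⁻¹ * φ (delta ω (x n * t))) atTop
      (nhds (φ (delta ω t)))) : ract φ Φ = φ := by
  refine dual_ext fun t => ?_
  rw [ract_apply]
  refine hΦ.apply_eq_of_tendsto ?_
  simpa only [lact_apply, normDelta_mul_delta, map_smul, smul_eq_mul] using h t

/-- A functional on the dual is positive if it is nonnegative on the functionals that are
nonnegative on point masses. -/
def IsPositive (Φ : StrongDual ℂ (StrongDual ℂ (Beurling ω))) : Prop :=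
  ∀ φ : StrongDual ℂ (Beurling ω), (∀ t, 0 ≤ φ (delta ω t)) → 0 ≤ Φ φ

theorem isPositive_of_isWeakStarAccPt {x : ℕ → G}
    {Φ : StrongDual ℂ (StrongDual ℂ (Beurling ω))}
    (hΦ : IsWeakStarAccPt (fun n => normDelta ω (x n)) Φ) : IsPositive Φ := by
  intro φ hφ
  refine hΦ.apply_mem_of_isClosed (C := Set.Ici 0) isClosed_Ici fun n => ?_
  rw [normDelta, map_smul, smul_eq_mul, ← Complex.ofReal_inv]
  exact mul_nonneg (Complex.zero_le_real.mpr (inv_nonneg.mpr (ω.pos' _).le)) (hφ _)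

theorem IsPositive.mul {Φ Ψ : DiamondBidual (Beurling ω)} (hΦ : IsPositive Φ.toDual)
    (hΨ : IsPositive Ψ.toDual) : IsPositive (Φ * Ψ).toDual := by
  intro φ hφ
  refine hΨ _ fun t => hΦ _ fun s => ?_
  rw [lact_apply, delta_mul_delta]
  exact hφ _

theorem norm_one_le : ‖(1 : DiamondBidual (Beurling ω))‖ ≤ 1 := by
  refine (NormedSpace.double_dual_bound ℂ (Beurling ω) 1).trans (le_of_eq ?_)
  have h := norm_normDelta (ω := ω) 1
  rw [normDelta, ω.map_one', Complex.ofReal_one, inv_one, one_smul] at h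
  exact h

/-- If a positive contraction fixes, from the right, a functional dominated by the weight, then all
its powers attain their norm at the weight. -/
theorem pow_apply_weightFunctional {T : DiamondBidual (Beurling ω)} (hT : IsPositive T.toDual)
    (hT1 : ‖T‖ ≤ 1) {φ : StrongDual ℂ (Beurling ω)} (hφ1 : φ (delta ω 1) = 1)
    (hφ : ∀ t, φ (delta ω t) ≤ ω t) (hfix : ract φ T.toDual = φ) (k : ℕ) :
    (T ^ k).toDual (weightFunctional ω) = 1 := by
  have hpow : ∀ k : ℕ, IsPositive (T ^ k).toDual ∧ ‖T ^ k‖ ≤ 1 ∧ (T ^ k).toDual φ = 1 := by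
    intro k
    induction k with
    | zero =>
      rw [pow_zero]
      exact ⟨fun ψ hψ => hψ 1, norm_one_le, hφ1⟩
    | succ k ih =>
      obtain ⟨h1, h2, h3⟩ := ih
      -- Splitting off `T` as the left factor lets it act on `φ` first, where `hfix` applies.
      rw [pow_succ']
      refine ⟨hT.mul h1, (norm_mul_le _ _).trans (mul_le_one₀ hT1 (norm_nonneg _) h2), ?_⟩
      rw [DiamondBidual.mul_def, diamond_apply, hfix, h3]
  obtain ⟨h1, h2, h3⟩ := hpow k
  -- In the complex order this gives real part at least 1 and imaginary part 0; the norm bound below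
  -- supplies real part at most 1.
  have hge : 0 ≤ (T ^ k).toDual (weightFunctional ω - φ) := h1 _ fun t => by
    rw [sub_apply, weightFunctional_delta]
    exact sub_nonneg.mpr (hφ t)
  rw [map_sub, h3, Complex.nonneg_iff] at hge
  have hle : ‖(T ^ k).toDual (weightFunctional ω)‖ ≤ 1 :=
    ((T ^ k).toDual.le_opNorm _).trans
      (mul_le_one₀ h2 (norm_nonneg _) norm_weightFunctional_le)
  have hre := (Complex.re_le_norm ((T ^ k).toDual (weightFunctional ω))).trans hle
  simp only [Complex.sub_re, Complex.sub_im, Complex.one_re, Complex.one_im] at hge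
  apply Complex.ext
  · rw [Complex.one_re]; linarith [hge.1]
  · rw [Complex.one_im]; linarith [hge.2]

end Beurling

/-! ### The functional fixed by both accumulation points. -/

namespace FreeThree

open Beurling Arens

theorem omega_apply (g : F3) : omega g = Real.exp (wordLength X g) := rfl

/-- The weight on the quotient by the third generator, twisted by its exponent sum. -/
def auxWeight (g : F3) : ℝ := Real.exp (wordLength X (killC g) + expSum 2 g)

theorem auxWeight_le (g : F3) : auxWeight g ≤ omega g :=
  Real.exp_le_exp.mpr (by exact_mod_cast wordLength_killC_add_le g)

theorem abs_auxWeight_le (g : F3) : |auxWeight g| ≤ omega g := by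
  rw [abs_of_pos (show 0 < auxWeight g from Real.exp_pos _)]
  exact auxWeight_le g

theorem eventually_auxWeight_mul (g : F3) : ∀ᶠ m in atTop,
    auxWeight (a ^ (5 ^ (2 * m)) * b ^ (5 ^ (2 * m)) * g) =
      omega (a ^ (5 ^ (2 * m)) * b ^ (5 ^ (2 * m))) * auxWeight g := by
  filter_upwards [eventually_wordLength_mul (killC g)] with m hm
  rw [auxWeight, omega_apply, auxWeight, ← Real.exp_add]
  simp [hm, add_assoc]

theorem auxWeight_c_pow_mul (n : ℕ) (g : F3) :
    auxWeight (c ^ n * g) = omega (c ^ n) * auxWeight g := by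
  rw [auxWeight, omega_apply, auxWeight, ← Real.exp_add, wordLength_c_pow]
  simp
  ring

theorem ract_auxWeight_eq_self {x : ℕ → F3}
    {Φ : StrongDual ℂ (StrongDual ℂ (Beurling omega))}
    (hΦ : IsWeakStarAccPt (fun n => normDelta omega (x n)) Φ)
    (h : ∀ g, ∀ᶠ n in Filter.atTop, auxWeight (x n * g) = omega (x n) * auxWeight g) :
    ract (functionalOfLe auxWeight abs_auxWeight_le) Φ =
      functionalOfLe auxWeight abs_auxWeight_le := by
  refine ract_eq_self_of_tendsto hΦ _ fun g => ?_
  refine Filter.Tendsto.congr' ?_ tendsto_const_nhds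
  filter_upwards [h g] with n hn
  have h0 : (omega (x n) : ℂ) ≠ 0 := Complex.ofReal_ne_zero.mpr (omega.pos' _).ne'
  rw [functionalOfLe_delta, functionalOfLe_delta, hn, Complex.ofReal_mul, inv_mul_cancel_left₀ h0]

end FreeThree

end

theorem proposition4p5
    (Φ₀ Ψ₀ : Arens.DiamondBidual (Beurling FreeThree.omega))
    (hΦ₀ : Arens.IsWeakStarAccPt
      (fun n : ℕ => Beurling.normDelta FreeThree.omega
        (FreeThree.a ^ (5 ^ (2 * n)) * FreeThree.b ^ (5 ^ (2 * n)))) Φ₀.toDual)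
    (hΨ₀ : Arens.IsWeakStarAccPt
      (fun n : ℕ => Beurling.normDelta FreeThree.omega (FreeThree.c ^ n)) Ψ₀.toDual) :
    ¬ Arens.IsQuasiNilpotent (Φ₀ * Ψ₀) ∧
      ∀ k : ℕ, ((Φ₀ * Ψ₀) ^ k).toDual (Beurling.weightFunctional FreeThree.omega) = 1 := by
  have hΦfix := FreeThree.ract_auxWeight_eq_self hΦ₀ FreeThree.eventually_auxWeight_mul
  have hΨfix := FreeThree.ract_auxWeight_eq_self hΨ₀
    fun g => Filter.Eventually.of_forall fun n => FreeThree.auxWeight_c_pow_mul n g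
  have hpow : ∀ k : ℕ,
      ((Φ₀ * Ψ₀) ^ k).toDual (Beurling.weightFunctional FreeThree.omega) = 1 := by
    refine Beurling.pow_apply_weightFunctional
      (φ := Beurling.functionalOfLe FreeThree.auxWeight FreeThree.abs_auxWeight_le)
      ((Beurling.isPositive_of_isWeakStarAccPt hΦ₀).mul
        (Beurling.isPositive_of_isWeakStarAccPt hΨ₀)) ?_ ?_ ?_ ?_
    · exact (norm_mul_le _ _).trans (mul_le_one₀
        (hΦ₀.norm_le_one fun n => (Beurling.norm_normDelta _).le) (norm_nonneg _)
        (hΨ₀.norm_le_one fun n => (Beurling.norm_normDelta _).le))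
    · simp [FreeThree.auxWeight, wordLength_one]
    · intro g
      rw [Beurling.functionalOfLe_delta]
      exact Complex.real_le_real.mpr (FreeThree.auxWeight_le g)
    -- Associativity moves `f` aside: `(f · φ) · Φ₀ = f · (φ · Φ₀) = f · φ`, after which the
    -- invariance under `Ψ₀` finishes.
    · refine ContinuousLinearMap.ext fun f => ?_
      have h1 := DFunLike.congr_fun hΦfix
      have h2 := DFunLike.congr_fun hΨfix f
      rw [Arens.ract_apply] at h2
      rw [Arens.ract_apply, Arens.DiamondBidual.mul_def, Arens.diamond_apply, ← h2]
      congr 1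
      ext g
      rw [Arens.ract_apply, Arens.lact_apply, ← h1, Arens.ract_apply]
      congr 1
      ext h
      simp [mul_assoc]
  refine ⟨Arens.not_isQuasiNilpotent_of_le_norm_pow fun k => ?_, hpow⟩
  have h := ((Φ₀ * Ψ₀) ^ k).toDual.le_opNorm (Beurling.weightFunctional FreeThree.omega)
  rw [hpow k, norm_one] at h
  exact h.trans (mul_le_of_le_one_right (norm_nonneg _) Beurling.norm_weightFunctional_le)
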